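/- Let $G,H,E,F$ be real Banach spaces, let $X\subseteq G$ and $Y\subseteq H$ be open, and let $1\le p\le\infty$, $0\le q\le\infty$. For $k\in\mathbb N\cup\{0\}$ let $D^k$ denote the $k$-th Fréchet derivative. $C^p(X,E)$ is the vector space of all $p$ times continuously (Fréchet) differentiable functions $f:X\to E$, with the locally convex topology generated by the seminorms $$\rho_{K,k}(f)=\sup_{x\in K}\ \sup_{0\le j\le k}\|D^jf(x)\|,\qquad K\subseteq X\text{ compact},\ k\in\mathbb N\cup\{0\},\ k\le p;$$ $C^q(Y,F)$ is defined and topologized in the same way. Assume that there is a bump function $\varphi\in C^p(G,\mathbb R)$ with $\varphi(x)=1$ if $\|x\|\le 1/2$, $\varphi(x)=0$ if $\|x\|\ge 1$, and $\sup_{x\in G}\|D^k\varphi(x)\|<\infty$ for all $k\in\mathbb N\cup\{0\}$ with $k\le p$. A linear operator $T:C^p(X,E)\to C^q(Y,F)$ is called *separating* if for all $f_1,f_2\in C^p(X,E)$ such that for every $x\in X$ either $f_1(x)=0$ or $f_2(x)=0$, one has for every $y\in Y$ either $Tf_1(y)=0$ or $Tf_2(y)=0$. It is called *nowhere trivial*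 if for every $y\in Y$ there is $f\in C^p(X,E)$ with $Tf(y)\ne0$. Put $A=C^p(X,\mathbb R)$, let $\mathbb R_\infty$ be the one-point compactification of $\mathbb R$, define $i:X\to\mathbb R_\infty^{A}$ by $i(x)(\psi)=\psi(x)$, and let $\mathcal AX$ be the closure of $i(X)$ in $\mathbb R_\infty^{A}$. For $f\in C^p(X,E)$ let $\overline C(f)$ be the closure of $i(\{x\in X: f(x)\neq 0\})$ in $\mathcal AX$. A *support map* of $T$ is a continuous map $h:\widetilde Y\to\mathcal AX$, where $\widetilde Y=\{y\in Y: Tf(y)\ne0\text{ for some }f\in C^p(X,E)\}$, such that $Tf(y)=0$ whenever $f\in C^p(X,E)$, $y\in\widetilde Y$ and $h(y)\notin\overline C(f)$. **Corollary.** Let $T:C^p(X,E)\to C^q(Y,F)$ be a continuous, separating, nowhere trivial linear operator (so that $\widetilde Y=Y$), and suppose that $q>p$. Then $T$ has exactly one support map; it takes its values in $i(X)$, that is, it is of the form $y\mapsto i(h(y))$ for a map $h:Y\to X$; and there is a partition of $Y$ into clopen subsets $(Y_\alpha)$ such that $h$ is constant on each $Y_\alpha$. -/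

import Mathlib

open Set TopologicalSpace

set_option linter.unusedSectionVars false

noncomputable section

section Space

variable {G : Type*} [NormedAddCommGroup G] [NormedSpace ℝ G]
variable {E : Type*} [NormedAddCommGroup E] [NormedSpace ℝ E]

/-- Extension by `0` of a function on the open set `X` to the whole space. Only its germs at
points of `X` are ever used, and these do not depend on the values outside `X`. -/
def extendZero {X : Opens G} (f : X → E) : G → E :=
  Function.extend (Subtype.val : X → G) f 0

theorem extendZero_add {X : Opens G} (f g : X → E) :
    extendZero (f + g) = extendZero f + extendZero g := by
  have h := Function.extend_add (Subtype.val : X → G) f g 0 0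
  rwa [add_zero] at h

theorem extendZero_smul {X : Opens G} (c : ℝ) (f : X → E) :
    extendZero (c • f) = c • extendZero f := by
  have h := Function.extend_smul c (Subtype.val : X → G) f 0
  rwa [smul_zero] at h

theorem extendZero_zero {X : Opens G} : extendZero (0 : X → E) = 0 :=
  Function.extend_zero _

/-- The vector space of `p` times continuously differentiable functions `X → E`. -/
def diffSubmodule (p : ℕ∞) (X : Opens G) (E : Type*) [NormedAddCommGroup E] [NormedSpace ℝ E] :
    Submodule ℝ (X → E) where
  carrier := {f | ContDiffOn ℝ p (extendZero f) (X : Set G)}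
  add_mem' := by
    intro f g hf hg
    change ContDiffOn ℝ p (extendZero (f + g)) (X : Set G)
    rw [extendZero_add]
    exact ContDiffOn.add hf hg
  zero_mem' := by
    change ContDiffOn ℝ p (extendZero (0 : X → E)) (X : Set G)
    rw [extendZero_zero]
    exact contDiffOn_const
  smul_mem' := by
    intro c f hf
    change ContDiffOn ℝ p (extendZero (c • f)) (X : Set G)
    rw [extendZero_smul]
    exact ContDiffOn.const_smul c hf

/-- The space `C^p(X, E)`, `X` open in the normed space `G`. It is a type of its own, so that it
does not inherit the topology of pointwise convergence. -/
def CDiff (p : ℕ∞) (X : Opens G) (E : Type*) [NormedAddCommGroup E] [NormedSpace ℝ E] :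
    Type _ :=
  diffSubmodule p X E

namespace CDiff

instance (p : ℕ∞) (X : Opens G) : AddCommGroup (CDiff p X E) :=
  inferInstanceAs (AddCommGroup (diffSubmodule p X E))

instance (p : ℕ∞) (X : Opens G) : Module ℝ (CDiff p X E) :=
  inferInstanceAs (Module ℝ (diffSubmodule p X E))

instance (p : ℕ∞) (X : Opens G) : CoeFun (CDiff p X E) (fun _ => X → E) :=
  ⟨fun f => Subtype.val f⟩

/-- The `k`-th Fréchet derivative `D^k f(x)`, for `x ∈ X`. -/
def derivAt {p : ℕ∞} {X : Opens G} (k : ℕ) (f : CDiff p X E) (x : X) : G [×k]→L[ℝ] E :=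
  iteratedFDeriv ℝ k (extendZero f) (x : G)

theorem contDiffAt {p : ℕ∞} {X : Opens G} (f : CDiff p X E) (x : X) :
    ContDiffAt ℝ p (extendZero f) (x : G) :=
  ContDiffOn.contDiffAt f.2 (X.isOpen.mem_nhds x.2)

theorem continuous_derivAt {p : ℕ∞} {X : Opens G} {k : ℕ} (hk : (k : ℕ∞) ≤ p)
    (f : CDiff p X E) : Continuous (derivAt k f) := by
  rw [continuous_iff_continuousAt]
  intro x
  have h : ContDiffAt ℝ k (extendZero f) (x : G) := (contDiffAt f x).of_le (by exact_mod_cast hk)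
  have h2 : ContinuousAt (iteratedFDeriv ℝ k (extendZero f)) (x : G) :=
    (h.iteratedFDeriv_right (m := 0) (i := k) (by simp)).continuousAt
  exact h2.comp continuous_subtype_val.continuousAt

theorem derivAt_add {p : ℕ∞} {X : Opens G} {k : ℕ} (hk : (k : ℕ∞) ≤ p)
    (f g : CDiff p X E) (x : X) : derivAt k (f + g) x = derivAt k f x + derivAt k g x := by
  have hf : ContDiffAt ℝ k (extendZero f) (x : G) := (contDiffAt f x).of_le (by exact_mod_cast hk)
  have hg : ContDiffAt ℝ k (extendZero g) (x : G) := (contDiffAt g x).of_le (by exact_mod_cast hk)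
  have h : extendZero (f + g : CDiff p X E) = extendZero f + extendZero g := extendZero_add _ _
  rw [derivAt, h]
  exact iteratedFDeriv_add_apply hf hg

theorem derivAt_smul {p : ℕ∞} {X : Opens G} {k : ℕ} (hk : (k : ℕ∞) ≤ p)
    (c : ℝ) (f : CDiff p X E) (x : X) : derivAt k (c • f) x = c • derivAt k f x := by
  have hf : ContDiffAt ℝ k (extendZero f) (x : G) := (contDiffAt f x).of_le (by exact_mod_cast hk)
  have h : extendZero (c • f : CDiff p X E) = c • extendZero f := extendZero_smul _ _
  rw [derivAt, h]
  exact iteratedFDeriv_const_smul_apply hf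

theorem bddAbove_derivAt {p : ℕ∞} {X : Opens G} (K : Compacts X) {k : ℕ} (hk : (k : ℕ∞) ≤ p)
    (f : CDiff p X E) :
    BddAbove (range fun z : K × {j : ℕ // j ≤ k} => ‖derivAt z.2.1 f z.1.1‖) := by
  have hj : ∀ j : {j : ℕ // j ≤ k}, BddAbove ((fun x : X => ‖derivAt j.1 f x‖) '' K) := fun j =>
    K.isCompact.bddAbove_image
      (continuous_derivAt (le_trans (by exact_mod_cast j.2) hk) f).norm.continuousOn
  choose C hC using hj
  have : Finite {j : ℕ // j ≤ k} := (Set.finite_Iic k).to_subtype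
  obtain ⟨M, hM⟩ := (Set.finite_range C).bddAbove
  refine ⟨M, ?_⟩
  rintro _ ⟨⟨x, j⟩, rfl⟩
  exact (hC j ⟨x.1, x.2, rfl⟩).trans (hM ⟨j, rfl⟩)

/-- The seminorm `ρ_{K,k}(f) = sup_{x ∈ K} sup_{0 ≤ j ≤ k} ‖D^j f(x)‖`, for `K ⊆ X` compact
and `k ≤ p`. -/
def rho {p : ℕ∞} {X : Opens G} (K : Compacts X) (k : {k : ℕ // (k : ℕ∞) ≤ p}) :
    Seminorm ℝ (CDiff p X E) :=
  Seminorm.of (fun f => ⨆ z : K × {j : ℕ // j ≤ k.1}, ‖derivAt z.2.1 f z.1.1‖)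
    (by
      intro f g
      refine Real.iSup_le (fun z => ?_)
        (add_nonneg (Real.iSup_nonneg fun _ => norm_nonneg _)
          (Real.iSup_nonneg fun _ => norm_nonneg _))
      rw [derivAt_add (le_trans (by exact_mod_cast z.2.2) k.2)]
      exact (norm_add_le _ _).trans
        (add_le_add (le_ciSup (bddAbove_derivAt K k.2 f) z)
          (le_ciSup (bddAbove_derivAt K k.2 g) z)))
    (by
      intro c f
      rw [Real.mul_iSup_of_nonneg (norm_nonneg c)]
      refine iSup_congr fun z => ?_
      rw [derivAt_smul (le_trans (by exact_mod_cast z.2.2) k.2), norm_smul])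

/-- The family of all seminorms `ρ_{K,k}`. -/
def rhoFamily (p : ℕ∞) (X : Opens G) (E : Type*) [NormedAddCommGroup E] [NormedSpace ℝ E] :
    SeminormFamily ℝ (CDiff p X E) (Compacts X × {k : ℕ // (k : ℕ∞) ≤ p}) :=
  fun i => rho i.1 i.2

/-- The locally convex topology of `C^p(X, E)` generated by the seminorms `ρ_{K,k}`. -/
instance (p : ℕ∞) (X : Opens G) : TopologicalSpace (CDiff p X E) :=
  (rhoFamily p X E).moduleFilterBasis.topology

/-- Disjointness of two functions. -/
def Disj {p : ℕ∞} {X : Opens G} (f₁ f₂ : CDiff p X E) : Prop :=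
  ∀ x : X, f₁ x = 0 ∨ f₂ x = 0

end CDiff

/-- A `C^p` bump function on `G` with bounded derivatives of all orders `k ≤ p`. -/
def HasBumpFunction (p : ℕ∞) (G : Type*) [NormedAddCommGroup G] [NormedSpace ℝ G] : Prop :=
  ∃ φ : G → ℝ, ContDiff ℝ p φ ∧ (∀ x, ‖x‖ ≤ 1 / 2 → φ x = 1) ∧ (∀ x, 1 ≤ ‖x‖ → φ x = 0) ∧
    ∀ k : ℕ, (k : ℕ∞) ≤ p → ∃ C : ℝ, ∀ x, ‖iteratedFDeriv ℝ k φ x‖ ≤ C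

/-- The map `i : X → ℝ_∞^{A(X)}`, `i(x)(φ) = φ(x)`, where `A(X) = C^p(X, ℝ)` and `ℝ_∞` is the
one-point compactification of `ℝ`. -/
def evalCube (p : ℕ∞) (X : Opens G) (x : X) : CDiff p X ℝ → OnePoint ℝ :=
  fun φ => ((φ x : ℝ) : OnePoint ℝ)

/-- The `C^p(X, ℝ)`-compactification of `X`: the closure of `i(X)` in `ℝ_∞^{A(X)}`. -/
abbrev Compactif (p : ℕ∞) (X : Opens G) : Type _ :=
  closure (range (evalCube p X))

/-- The embedding `i` of `X` into its compactification. -/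
def toCompactif (p : ℕ∞) (X : Opens G) (x : X) : Compactif p X :=
  ⟨evalCube p X x, subset_closure (mem_range_self x)⟩

/-- The closure, in the compactification, of `i({x | f x ≠ 0})`. -/
def closedSupport {p : ℕ∞} {X : Opens G} (f : CDiff p X E) : Set (Compactif p X) :=
  closure (toCompactif p X '' {x | f x ≠ 0})

end Space

section Operator

variable {G : Type*} [NormedAddCommGroup G] [NormedSpace ℝ G]
variable {H : Type*} [NormedAddCommGroup H] [NormedSpace ℝ H]
variable {E : Type*} [NormedAddCommGroup E] [NormedSpace ℝ E]
variable {F : Type*} [NormedAddCommGroup F] [NormedSpace ℝ F]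
variable {p q : ℕ∞} {X : Opens G} {Y : Opens H}

/-- `T` is separating (disjointness preserving). -/
def IsSeparating (T : CDiff p X E →ₗ[ℝ] CDiff q Y F) : Prop :=
  ∀ f₁ f₂ : CDiff p X E, f₁.Disj f₂ → (T f₁).Disj (T f₂)

/-- The set of all `y ∈ Y` at which `T f` does not vanish for some `f`. -/
def nontrivialSet (T : CDiff p X E →ₗ[ℝ] CDiff q Y F) : Set Y :=
  {y | ∃ f : CDiff p X E, T f y ≠ 0}

/-- `T` is nowhere trivial. -/
def IsNowhereTrivial (T : CDiff p X E →ₗ[ℝ] CDiff q Y F) : Prop :=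
  ∀ y : Y, ∃ f : CDiff p X E, T f y ≠ 0

/-- `h` is a support map of `T`: a continuous map from `{y | ∃ f, T f y ≠ 0}` into the
compactification of `X` such that `T f y = 0` whenever `h y` is not in the closed support
of `f`. -/
structure IsSupportMap (T : CDiff p X E →ₗ[ℝ] CDiff q Y F)
    (h : nontrivialSet T → Compactif p X) : Prop where
  continuous : Continuous h
  eq_zero : ∀ (f : CDiff p X E) (y : nontrivialSet T), h y ∉ closedSupport f → T f y.1 = 0

end Operator

end

open Filter Topology

/-! ### Cutoffs, Leibniz and Taylor estimates in `CDiff`. -/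

section Functions

variable {G : Type*} [NormedAddCommGroup G] [NormedSpace ℝ G]
variable {E : Type*} [NormedAddCommGroup E] [NormedSpace ℝ E]

/-! Since `p < q`, `p` is a finite `n`. Continuity makes `f ↦ T f y` depend only on a compact set,
and separation together with cutoffs localizes it to a single point `h y` (`exists_isSupportPoint`);
bump functions then give continuity of `h` and uniqueness of the support map.

Local constancy comes from a mismatch of orders. For `w` near `y`, let `2r` be the distance from `h
w` to `h y` and cut `f`, with `T f y ≠ 0`, down to the ball of radius `r` about `h y`. The cutoff
`g` has derivatives up to order `n` of size `O(r⁻ⁿ)`, so continuity of `T` bounds the derivative of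
order `n + 1` of `T g` by `O(r⁻ⁿ)`. But `T g` vanishes near `w` and equals `T f` at `y`, so Taylor
gives `‖T f y‖ ≤ C r⁻ⁿ ‖w - y‖ⁿ⁺¹` (`exists_dist_pow_le`). Thus `h` is Hölder of exponent `(n + 1) /
n > 1` at each point of a segment, has derivative zero along it, and is constant there. -/

theorem extendZero_apply {X : Opens G} (f : X → E) (x : X) : extendZero f (x : G) = f x :=
  Subtype.val_injective.extend_apply f 0 x

theorem extendZero_smul_restrict {X : Opens G} (ψ : G → ℝ) (f : X → E) :
    extendZero (fun x : X => ψ x • f x) = fun z => ψ z • extendZero f z := by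
  funext z
  by_cases hz : z ∈ X
  · have h₁ := extendZero_apply (fun x : X => ψ x • f x) ⟨z, hz⟩
    have h₂ := extendZero_apply f ⟨z, hz⟩
    simp only at h₁ h₂
    rw [h₁, h₂]
  · have hz' : ¬ ∃ a : X, (a : G) = z := by
      rintro ⟨a, rfl⟩
      exact hz a.2
    simp [extendZero, Function.extend_apply' _ _ _ hz']

namespace CDiff

/-- The product of a globally defined scalar function and an element of `C^p(X, E)`. -/
def smulFun {p : ℕ∞} {X : Opens G} (ψ : G → ℝ) (hψ : ContDiff ℝ p ψ) (f : CDiff p X E) :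
    CDiff p X E :=
  ⟨fun x => ψ x • f x, by
    change ContDiffOn ℝ p (extendZero fun x : X => ψ x • f x) (X : Set G)
    rw [extendZero_smul_restrict]
    exact hψ.contDiffOn.smul f.2⟩

theorem smulFun_apply {p : ℕ∞} {X : Opens G} (ψ : G → ℝ) (hψ : ContDiff ℝ p ψ)
    (f : CDiff p X E) (x : X) : smulFun ψ hψ f x = ψ x • f x := rfl

theorem sub_apply {p : ℕ∞} {X : Opens G} (f g : CDiff p X E) (x : X) :
    (f - g) x = f x - g x := rfl

theorem norm_derivAt_zero {p : ℕ∞} {X : Opens G} (f : CDiff p X E) (x : X) :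
    ‖derivAt 0 f x‖ = ‖f x‖ := by
  rw [derivAt, norm_iteratedFDeriv_zero, extendZero_apply]

theorem continuous_coe {p : ℕ∞} {X : Opens G} (f : CDiff p X E) :
    Continuous (f : X → E) := by
  have h : (f : X → E) = fun x : X => extendZero (f : X → E) (x : G) := by
    funext x
    rw [extendZero_apply]
  rw [h, continuous_iff_continuousAt]
  exact fun x => ContinuousAt.comp (f := Subtype.val) (contDiffAt f x).continuousAt
    continuous_subtype_val.continuousAt

theorem derivAt_eq_zero_of_eventually {p : ℕ∞} {X : Opens G} {f : CDiff p X E} {x : X}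
    (h : ∀ᶠ z in 𝓝 x, f z = 0) (k : ℕ) : derivAt k f x = 0 := by
  have h' : extendZero f =ᶠ[𝓝 (x : G)] fun _ => 0 := by
    have h₁ := X.isOpen.isOpenEmbedding_subtypeVal.map_nhds_eq x
    change ∀ᶠ z in 𝓝 (x : G), extendZero f z = 0
    rw [← h₁, eventually_map]
    filter_upwards [h] with z hz
    exact (extendZero_apply _ z).trans hz
  rw [derivAt, (h'.iteratedFDeriv ℝ k).self_of_nhds]
  exact congrFun iteratedFDeriv_fun_zero _

theorem norm_derivAt_smulFun_le {p : ℕ∞} {X : Opens G} (ψ : G → ℝ) (hψ : ContDiff ℝ p ψ)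
    (f : CDiff p X E) {j : ℕ} (hj : (j : ℕ∞) ≤ p) (x : X) :
    ‖derivAt j (smulFun ψ hψ f) x‖ ≤ ∑ i ∈ Finset.range (j + 1),
      (j.choose i : ℝ) * ‖iteratedFDeriv ℝ i ψ x‖ * ‖derivAt (j - i) f x‖ := by
  have h := norm_iteratedFDerivWithin_smul_le (hψ.contDiffOn (s := (X : Set G))) f.2
    X.isOpen.uniqueDiffOn x.2 (n := j) (by exact_mod_cast hj)
  simp only [iteratedFDerivWithin_of_isOpen _ X.isOpen x.2] at h
  have h₁ : extendZero (smulFun ψ hψ f : X → E) = fun z => ψ z • extendZero f z :=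
    extendZero_smul_restrict ψ f
  rw [derivAt, h₁]
  exact h

theorem rho_apply {p : ℕ∞} {X : Opens G} (K : Compacts X) (k : {k : ℕ // (k : ℕ∞) ≤ p})
    (f : CDiff p X E) :
    rho K k f = ⨆ z : K × {j : ℕ // j ≤ k.1}, ‖derivAt z.2.1 f z.1.1‖ := rfl

theorem norm_derivAt_le_rho {p : ℕ∞} {X : Opens G} {K : Compacts X}
    {k : {k : ℕ // (k : ℕ∞) ≤ p}} (f : CDiff p X E) {j : ℕ} (hj : j ≤ k.1) {x : X} (hx : x ∈ K) :
    ‖derivAt j f x‖ ≤ rho K k f :=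
  le_ciSup (bddAbove_derivAt K k.2 f) (⟨⟨x, hx⟩, ⟨j, hj⟩⟩ : K × {j : ℕ // j ≤ k.1})

theorem withSeminorms (p : ℕ∞) (X : Opens G) : WithSeminorms (rhoFamily p X E) := ⟨rfl⟩

/-- A Taylor estimate along a segment, based at a point near which the function vanishes. -/
theorem norm_le_of_segment {q : ℕ∞} {X : Opens G} (f : CDiff q X E) {N : ℕ} (hN : (N : ℕ∞) ≤ q)
    {a b : X} (hab : segment ℝ (a : G) b ⊆ X) (ha : ∀ᶠ z in 𝓝 a, f z = 0) {M : ℝ}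
    (hM : ∀ z : X, (z : G) ∈ segment ℝ (a : G) b → ‖derivAt N f z‖ ≤ M) :
    ‖f b‖ ≤ M * ‖(b : G) - a‖ ^ N := by
  have hM0 : 0 ≤ M := (norm_nonneg _).trans (hM a (left_mem_segment ℝ _ _))
  -- Descending induction on the order `j`: every derivative vanishes at `a`, so each use of the
  -- mean value inequality gains one factor `‖z - a‖`.
  have key : ∀ k j : ℕ, j + k = N → ∀ z : X, (z : G) ∈ segment ℝ (a : G) b →
      ‖derivAt j f z‖ ≤ M * ‖(z : G) - a‖ ^ k := by
    intro k
    induction k with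
    | zero =>
      intro j hj z hz
      obtain rfl : j = N := hj
      simpa using hM z hz
    | succ k ih =>
      intro j hj z hz
      have hsub : segment ℝ (a : G) z ⊆ segment ℝ (a : G) b :=
        (convex_segment _ _).segment_subset (left_mem_segment ℝ _ _) hz
      have hjq : (j : WithTop ℕ∞) < (q : WithTop ℕ∞) := by
        have : (j : ℕ∞) < q := lt_of_lt_of_le (by exact_mod_cast (by omega : j < N)) hN
        exact_mod_cast this
      have h := Convex.norm_image_sub_le_of_norm_hasFDerivWithin_le (𝕜 := ℝ)
        (f := iteratedFDeriv ℝ j (extendZero f))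
        (f' := fderiv ℝ (iteratedFDeriv ℝ j (extendZero f))) (C := M * ‖(z : G) - a‖ ^ k)
        (s := segment ℝ (a : G) z) (x := (a : G)) (y := (z : G))
        (fun w hw => ((contDiffAt f ⟨w, hab (hsub hw)⟩).differentiableAt_iteratedFDeriv
          hjq).hasFDerivAt.hasFDerivWithinAt)
        (fun w hw => by
          rw [norm_fderiv_iteratedFDeriv]
          refine (ih (j + 1) (by omega) ⟨w, hab (hsub hw)⟩ (hsub hw)).trans ?_
          have : ‖w - (a : G)‖ ≤ ‖(z : G) - a‖ := by
            obtain ⟨t, ⟨ht0, ht1⟩, rfl⟩ := (segment_eq_image' ℝ (a : G) z) ▸ hw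
            simp only [add_sub_cancel_left, norm_smul, Real.norm_of_nonneg ht0]
            exact mul_le_of_le_one_left (norm_nonneg _) ht1
          gcongr)
        (convex_segment _ _) (left_mem_segment ℝ _ _) (right_mem_segment ℝ _ _)
      have h0 : iteratedFDeriv ℝ j (extendZero f) (a : G) = 0 :=
        derivAt_eq_zero_of_eventually ha j
      rw [h0, sub_zero, mul_assoc, ← pow_succ] at h
      exact h
  have h := key N 0 (zero_add N) b (right_mem_segment ℝ _ _)
  rwa [norm_derivAt_zero] at h

end CDiff

/-- Rescaled and translated bump functions, with the growth of their derivatives. -/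
theorem HasBumpFunction.exists_scaled {n : ℕ} (hb : HasBumpFunction (n : ℕ∞) G) :
    ∃ B : ℝ, 0 ≤ B ∧ ∀ (x : G) (r : ℝ), 0 < r → ∃ ψ : G → ℝ, ContDiff ℝ ((n : ℕ∞) : WithTop ℕ∞) ψ ∧
      (∀ z, dist z x ≤ r / 2 → ψ z = 1) ∧ (∀ z, r ≤ dist z x → ψ z = 0) ∧
      ∀ j ≤ n, ∀ z, ‖iteratedFDeriv ℝ j ψ z‖ ≤ B * r⁻¹ ^ j := by
  obtain ⟨φ, hφ, h1, h0, hC⟩ := hb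
  choose C hC using hC
  have hC0 : ∀ (j : ℕ) (hj : (j : ℕ∞) ≤ n), 0 ≤ C j hj := fun j hj =>
    (norm_nonneg _).trans (hC j hj 0)
  -- The bounds are made total, with value 0 above order `n`, so that their sum is one constant
  -- serving every `j ≤ n`.
  let C' : ℕ → ℝ := fun j => if hj : (j : ℕ∞) ≤ n then C j hj else 0
  have hC'0 : ∀ j, 0 ≤ C' j := fun j => by
    by_cases hj : (j : ℕ∞) ≤ n
    · simpa only [C', dif_pos hj] using hC0 j hj
    · simp only [C', dif_neg hj, le_refl]
  refine ⟨∑ j ∈ Finset.range (n + 1), C' j, Finset.sum_nonneg fun j _ => hC'0 j, ?_⟩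
  intro x r hr
  have hnorm : ∀ z, ‖r⁻¹ • (z - x)‖ = dist z x / r := fun z => by
    rw [norm_smul, norm_inv, Real.norm_of_nonneg hr.le, dist_eq_norm, div_eq_inv_mul]
  refine ⟨fun z => φ (r⁻¹ • (z - x)), by fun_prop, fun z hz => h1 _ ?_, fun z hz => h0 _ ?_, ?_⟩
  · rw [hnorm, div_le_iff₀ hr]
    linarith
  · rw [hnorm, le_div_iff₀ hr]
    linarith
  · intro j hj z
    have hj' : (j : ℕ∞) ≤ n := by exact_mod_cast hj
    rw [iteratedFDeriv_comp_sub (f := fun z => φ (r⁻¹ • z)) j x z,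
      iteratedFDeriv_comp_const_smul r⁻¹ (hφ.of_le (by exact_mod_cast hj')), norm_smul, norm_pow,
      norm_inv, Real.norm_of_nonneg hr.le, mul_comm]
    refine mul_le_mul_of_nonneg_right ?_ (by positivity)
    calc _ ≤ C j hj' := hC j hj' _
      _ = C' j := by simp only [C', dif_pos hj']
      _ ≤ _ := Finset.single_le_sum (f := C') (fun i _ => hC'0 i)
          (Finset.mem_range.2 (by omega))

end Functions

/-! ### Support points and the support map. -/

section SeparatingOperator

variable {G : Type*} [NormedAddCommGroup G] [NormedSpace ℝ G]
variable {H : Type*} [NormedAddCommGroup H] [NormedSpace ℝ H]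
variable {E : Type*} [NormedAddCommGroup E] [NormedSpace ℝ E]
variable {F : Type*} [NormedAddCommGroup F] [NormedSpace ℝ F]
variable {n : ℕ} {q : ℕ∞} {X : Opens G} {Y : Opens H}

/-- Finitely many seminorms control the target seminorm; the union of their compact sets is `K`, and
since `n` is finite their orders are all at most `n`. -/
theorem CDiff.exists_bound_of_continuous (T : CDiff (n : ℕ∞) X E →ₗ[ℝ] CDiff q Y F)
    (hT : Continuous T) (L : Compacts Y) {l : ℕ} (hl : (l : ℕ∞) ≤ q) :
    ∃ K : Compacts X, ∃ C : ℝ, 0 ≤ C ∧ ∀ (f : CDiff (n : ℕ∞) X E) (B : ℝ), 0 ≤ B →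
      (∀ x ∈ K, ∀ j ≤ n, ‖derivAt j f x‖ ≤ B) → ∀ y ∈ L, ‖derivAt l (T f) y‖ ≤ C * B := by
  have hq : Continuous ((rho L ⟨l, hl⟩ : Seminorm ℝ (CDiff q Y F)).comp T) :=
    ((withSeminorms q Y).continuous_seminorm (L, ⟨l, hl⟩)).comp hT
  obtain ⟨s, C, -, hC⟩ := Seminorm.bound_of_continuous (withSeminorms (n : ℕ∞) X) _ hq
  refine ⟨s.sup Prod.fst, C, C.2, fun f B hB hf y hy => ?_⟩
  refine (norm_derivAt_le_rho (k := ⟨l, hl⟩) (T f) le_rfl hy).trans ((hC f).trans ?_)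
  refine mul_le_mul_of_nonneg_left ?_ C.2
  refine Seminorm.finset_sup_apply_le hB fun i hi => ?_
  change rho i.1 i.2 f ≤ B
  rw [rho_apply]
  refine Real.iSup_le (fun z => hf _ ?_ _ ?_) hB
  · exact (Finset.le_sup (f := Prod.fst) hi : i.1 ≤ s.sup Prod.fst) z.1.2
  · exact z.2.2.trans (by exact_mod_cast i.2.2)

/-- The functional `f ↦ T f y` is supported at `x`. -/
def IsSupportPoint {p : ℕ∞} (T : CDiff p X E →ₗ[ℝ] CDiff q Y F) (y : Y) (x : X) : Prop :=
  ∀ f : CDiff p X E, (∀ᶠ z in 𝓝 x, f z = 0) → T f y = 0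

/-- If `x` is not a support point, some `f₀` vanishing near `x` has `T f₀ y ≠ 0`; separation then
kills at `y` every `f` supported in a small ball about `x`. Finitely many such balls cover the
compact set that controls `T f y`, which would force `T f y = 0` for all `f`. -/
theorem exists_isSupportPoint (hb : HasBumpFunction (n : ℕ∞) G)
    (T : CDiff (n : ℕ∞) X E →ₗ[ℝ] CDiff q Y F) (hT : Continuous T) (hsep : IsSeparating T)
    {y : Y} (hy : ∃ f, T f y ≠ 0) : ∃ x : X, IsSupportPoint T y x := by
  by_contra! hno
  obtain ⟨B, -, hB⟩ := hb.exists_scaled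
  have hloc : ∀ x : X, ∃ r > 0, ∀ f : CDiff (n : ℕ∞) X E,
      (∀ z : X, r ≤ dist z x → f z = 0) → T f y = 0 := by
    intro x
    have hx := hno x
    simp only [IsSupportPoint, not_forall] at hx
    obtain ⟨f₀, hf₀, hT₀⟩ := hx
    obtain ⟨r, hr, hball⟩ := Metric.eventually_nhds_iff.1 hf₀
    refine ⟨r, hr, fun f hf => ?_⟩
    refine (hsep f f₀ (fun z => ?_) y).resolve_right hT₀
    by_cases hz : dist z x < r
    · exact Or.inr (hball hz)
    · exact Or.inl (hf z (not_lt.1 hz))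
  obtain ⟨K, C, hC0, hC⟩ := CDiff.exists_bound_of_continuous T hT ⟨{y}, isCompact_singleton⟩
    (l := 0) (by simp)
  -- `P u`: the functional at `y` kills every `f` that vanishes near the points of `K` outside `u`.
  -- Starting from `∅`, `u` is enlarged by half-balls until it contains `K`, where the condition on
  -- `f` is void.
  let P : Set X → Prop := fun u => ∀ f : CDiff (n : ℕ∞) X E,
    (∀ x ∈ K, x ∉ u → ∀ᶠ z in 𝓝 x, f z = 0) → T f y = 0
  have hmono : ∀ {u v : Set X}, u ⊆ v → P v → P u := fun huv hv f hf =>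
    hv f fun x hx hxv => hf x hx fun hxu => hxv (huv hxu)
  have hempty : P ∅ := by
    intro f hf
    have h := hC f 0 le_rfl (fun x hx j _ => by
      rw [CDiff.derivAt_eq_zero_of_eventually (hf x hx (notMem_empty x)), norm_zero]) y
      (mem_singleton y)
    rw [CDiff.norm_derivAt_zero, mul_zero] at h
    exact norm_le_zero_iff.1 h
  have hK : ∀ u, P u → P (u ∪ K) := by
    refine K.isCompact.induction_on (p := fun s => ∀ u, P u → P (u ∪ s)) ?_ ?_ ?_ ?_
    · intro u hu
      rwa [union_empty]
    · exact fun s t hst ht u hu => hmono (union_subset_union_right u hst) (ht u hu)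
    · intro s t hs ht u hu
      rw [← union_assoc]
      exact ht _ (hs u hu)
    · intro x _
      obtain ⟨r, hr, hfr⟩ := hloc x
      refine ⟨Metric.ball x (r / 2), mem_nhdsWithin_of_mem_nhds
        (Metric.ball_mem_nhds x (half_pos hr)), fun u hu f hf => ?_⟩
      obtain ⟨ψ, hψ, h1, h0, -⟩ := hB x r hr
      -- Split `f = ψ f + (f - ψ f)`: the first term lives in the ball about `x`, the second
      -- vanishes on the half-ball and so falls under `P u`.
      have hin : T (CDiff.smulFun ψ hψ f) y = 0 := hfr _ fun z hz => by
        rw [CDiff.smulFun_apply, h0 z hz, zero_smul]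
      have hout : T (f - CDiff.smulFun ψ hψ f) y = 0 := by
        refine hu _ fun z hz hzu => ?_
        by_cases hzb : z ∈ Metric.ball x (r / 2)
        · filter_upwards [Metric.isOpen_ball.mem_nhds hzb] with w hw
          rw [CDiff.sub_apply, CDiff.smulFun_apply, h1 w (le_of_lt hw), one_smul, sub_self]
        · filter_upwards [hf z hz fun h => h.elim hzu hzb] with w hw
          rw [CDiff.sub_apply, CDiff.smulFun_apply, hw, smul_zero, sub_self]
      rwa [map_sub, CDiff.sub_apply, hin, sub_zero] at hout
  obtain ⟨f, hf⟩ := hy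
  exact hf (hK ∅ hempty f fun x hx hxK => absurd (Or.inr hx) hxK)

theorem IsSupportPoint.apply_smulFun {p : ℕ∞} {T : CDiff p X E →ₗ[ℝ] CDiff q Y F} {y : Y} {x : X}
    (hx : IsSupportPoint T y x) {ψ : G → ℝ} (hψ : ContDiff ℝ p ψ) {r : ℝ} (hr : 0 < r)
    (h1 : ∀ z, dist z (x : G) ≤ r / 2 → ψ z = 1) (f : CDiff p X E) :
    T (CDiff.smulFun ψ hψ f) y = T f y := by
  have h : T (f - CDiff.smulFun ψ hψ f) y = 0 := by
    refine hx _ ?_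
    filter_upwards [Metric.ball_mem_nhds x (half_pos hr)] with z hz
    rw [CDiff.sub_apply, CDiff.smulFun_apply, h1 z (le_of_lt hz), one_smul, sub_self]
  rw [map_sub, CDiff.sub_apply] at h
  exact (sub_eq_zero.1 h).symm

theorem IsSupportPoint.apply_eq_zero {p : ℕ∞} {T : CDiff p X E →ₗ[ℝ] CDiff q Y F} {y : Y}
    {x : X} (hx : IsSupportPoint T y x) {a : X} {r : ℝ} (hr : r < dist x a) {f : CDiff p X E}
    (hf : ∀ z : X, r ≤ dist z a → f z = 0) : T f y = 0 := by
  refine hx f ?_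
  filter_upwards [(isOpen_lt continuous_const
    (continuous_id.dist continuous_const)).mem_nhds (show x ∈ {z : X | r < dist z a} from hr)]
    with z hz using hf z (le_of_lt hz)

/-- With `ψ` a bump about `h y`, `T (ψ f)` is nonzero at `y`, hence nearby, and wherever it is
nonzero `h` must stay close to `h y`. -/
theorem continuous_of_isSupportPoint (hb : HasBumpFunction (n : ℕ∞) G)
    {T : CDiff (n : ℕ∞) X E →ₗ[ℝ] CDiff q Y F} (hnt : IsNowhereTrivial T)
    {h : Y → X} (hh : ∀ y, IsSupportPoint T y (h y)) : Continuous h := by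
  obtain ⟨B, -, hB⟩ := hb.exists_scaled
  rw [continuous_iff_continuousAt]
  intro y
  refine Metric.nhds_basis_closedBall.tendsto_right_iff.2 fun r hr => ?_
  obtain ⟨f, hf⟩ := hnt y
  obtain ⟨ψ, hψ, h1, h0, -⟩ := hB (h y) r hr
  have hne : T (CDiff.smulFun ψ hψ f) y ≠ 0 := by
    rwa [(hh y).apply_smulFun hψ hr h1]
  filter_upwards [(CDiff.continuous_coe (T (CDiff.smulFun ψ hψ f))).continuousAt.eventually_ne
    hne] with w hw
  rw [Metric.mem_closedBall]
  by_contra! hlt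
  exact hw ((hh w).apply_eq_zero hlt fun z hz => by
    rw [CDiff.smulFun_apply, h0 z hz, zero_smul])

theorem continuous_toCompactif (p : ℕ∞) (X : Opens G) : Continuous (toCompactif p X) :=
  Continuous.subtype_mk (continuous_pi fun φ =>
    OnePoint.continuous_coe.comp (CDiff.continuous_coe φ)) _

theorem isSupportMap_of_isSupportPoint {p : ℕ∞} {T : CDiff p X E →ₗ[ℝ] CDiff q Y F} {h : Y → X}
    (hcont : Continuous h) (hh : ∀ y, IsSupportPoint T y (h y)) :
    IsSupportMap T (fun y => toCompactif p X (h y.1)) where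
  continuous := (continuous_toCompactif p X).comp (hcont.comp continuous_subtype_val)
  eq_zero f y hy := by
    refine hh y.1 f ?_
    have hU : (toCompactif p X ⁻¹' (closedSupport f)ᶜ) ∈ 𝓝 (h y.1) :=
      (isClosed_closure.isOpen_compl.preimage (continuous_toCompactif p X)).mem_nhds hy
    filter_upwards [hU] with z hz
    by_contra hfz
    exact hz (subset_closure ⟨z, hfz, rfl⟩)

/-- Were the values at `y` different, a cutoff of `f` near `h y` would keep `T f y ≠ 0` while its
closed support misses `k y`, because the compactification is Hausdorff. -/
theorem IsSupportMap.eq_of_isSupportPoint (hb : HasBumpFunction (n : ℕ∞) G)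
    {T : CDiff (n : ℕ∞) X E →ₗ[ℝ] CDiff q Y F} {h : Y → X}
    (hh : ∀ y, IsSupportPoint T y (h y)) {k : nontrivialSet T → Compactif (n : ℕ∞) X}
    (hk : IsSupportMap T k) : k = fun y => toCompactif (n : ℕ∞) X (h y.1) := by
  obtain ⟨B, -, hB⟩ := hb.exists_scaled
  funext y
  by_contra hne
  obtain ⟨V, U, hV, hU, hkV, hhU, hVU⟩ := t2_separation hne
  obtain ⟨r, hr, hball⟩ := Metric.mem_nhds_iff.1
    ((hU.preimage (continuous_toCompactif (n : ℕ∞) X)).mem_nhds hhU)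
  obtain ⟨f, hf⟩ := y.2
  obtain ⟨ψ, hψ, h1, h0, -⟩ := hB (h y.1) r hr
  refine hf ?_
  rw [← (hh y.1).apply_smulFun hψ hr h1]
  refine hk.eq_zero _ y fun hmem => ?_
  obtain ⟨_, hzV, z, hz, rfl⟩ := mem_closure_iff.1 hmem V hV hkV
  refine disjoint_left.1 hVU hzV (hball ?_)
  rw [Metric.mem_ball]
  by_contra! hle
  exact hz (by rw [CDiff.smulFun_apply, h0 z hle, zero_smul])

end SeparatingOperator

/-! ### Superlinear Hölder estimate and local constancy. -/

section LocalConstancy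

variable {G : Type*} [NormedAddCommGroup G] [NormedSpace ℝ G]
variable {H : Type*} [NormedAddCommGroup H] [NormedSpace ℝ H]
variable {E : Type*} [NormedAddCommGroup E] [NormedSpace ℝ E]
variable {F : Type*} [NormedAddCommGroup F] [NormedSpace ℝ F]
variable {n : ℕ} {q : ℕ∞} {X : Opens G} {Y : Opens H}

/-- The compact set `L` is fixed in advance so that the constant does not depend on `w`; it must
contain the segments along which Taylor is applied. -/
theorem exists_dist_pow_le (hb : HasBumpFunction (n : ℕ∞) G) (hn : n ≠ 0)
    (hnq : (n : ℕ∞) < q) {T : CDiff (n : ℕ∞) X E →ₗ[ℝ] CDiff q Y F} (hT : Continuous T)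
    (hnt : IsNowhereTrivial T)
    {h : Y → X} (hcont : Continuous h) (hh : ∀ y, IsSupportPoint T y (h y)) (L : Compacts Y)
    {y : Y} (hL : ∀ w ∈ L, segment ℝ (w : H) y ⊆ (↑) '' (L : Set Y)) :
    ∃ C : ℝ, ∀ᶠ w in 𝓝 y, w ∈ L →
      dist (h w) (h y) ^ n ≤ C * ‖(w : H) - y‖ ^ (n + 1) := by
  obtain ⟨B, hB0, hB⟩ := hb.exists_scaled
  have hl : ((n + 1 : ℕ) : ℕ∞) ≤ q := by exact_mod_cast Order.add_one_le_of_lt hnq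
  obtain ⟨K, C, hC0, hC⟩ := CDiff.exists_bound_of_continuous T hT L hl
  obtain ⟨f, hf⟩ := hnt y
  set M : ℝ := CDiff.rho K ⟨n, le_rfl⟩ f
  have hM0 : 0 ≤ M := apply_nonneg _ _
  have hf0 : 0 < ‖T f y‖ := norm_pos_iff.2 hf
  refine ⟨2 ^ n * (C * (2 ^ n * B * M)) / ‖T f y‖, ?_⟩
  have hnear : ∀ᶠ w in 𝓝 y, dist (h w) (h y) < 1 :=
    hcont.continuousAt.eventually (Metric.ball_mem_nhds (h y) one_pos)
  filter_upwards [hnear] with w hw1 hwL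
  rw [div_mul_eq_mul_div, le_div_iff₀ hf0]
  obtain hd | hd := (dist_nonneg (x := h w) (y := h y)).eq_or_lt
  · rw [← hd, zero_pow hn, zero_mul]
    positivity
  set r := dist (h w) (h y) / 2 with hr
  have hr0 : 0 < r := half_pos hd
  -- This is why `w` is taken close to `y`: with `r ≤ 1`, the power `r⁻¹ ^ n` dominates all lower
  -- ones in the Leibniz sum.
  have hr1 : 1 ≤ r⁻¹ := (one_le_inv₀ hr0).2 (by linarith)
  obtain ⟨ψ, hψ, h1, h0, hder⟩ := hB (h y) r hr0
  set g := CDiff.smulFun ψ hψ f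
  have hgK : ∀ x ∈ K, ∀ j ≤ n, ‖CDiff.derivAt j g x‖ ≤ 2 ^ n * B * M * r⁻¹ ^ n := by
    intro x hx j hj
    refine (CDiff.norm_derivAt_smulFun_le ψ hψ f (by exact_mod_cast hj) x).trans ?_
    calc _ ≤ ∑ i ∈ Finset.range (j + 1), (j.choose i : ℝ) * (B * r⁻¹ ^ n) * M := by
          refine Finset.sum_le_sum fun i hi => ?_
          have hij : i ≤ j := Nat.lt_succ_iff.1 (Finset.mem_range.1 hi)
          have h₁ : ‖iteratedFDeriv ℝ i ψ x‖ ≤ B * r⁻¹ ^ n :=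
            (hder i (hij.trans hj) x).trans
              (mul_le_mul_of_nonneg_left (pow_le_pow_right₀ hr1 (hij.trans hj)) hB0)
          have h₂ : ‖CDiff.derivAt (j - i) f x‖ ≤ M :=
            CDiff.norm_derivAt_le_rho (k := ⟨n, le_rfl⟩) f ((Nat.sub_le _ _).trans hj) hx
          gcongr
      _ = 2 ^ j * (B * r⁻¹ ^ n) * M := by
          rw [← Finset.sum_mul, ← Finset.sum_mul]
          congr 2
          exact_mod_cast Nat.sum_range_choose j
      _ ≤ 2 ^ n * (B * r⁻¹ ^ n) * M := by
          gcongr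
          norm_num
      _ = _ := by ring
  have hsub := hL w hwL
  -- `h w` is at distance `2r` from `h y`, so by continuity `h v` stays outside the ball of radius
  -- `r` that supports `g`.
  have hgw : ∀ᶠ v in 𝓝 w, T g v = 0 := by
    have : ∀ᶠ v in 𝓝 w, r < dist (h v) (h y) :=
      (hcont.dist continuous_const).continuousAt.eventually (lt_mem_nhds (half_lt_self hd))
    filter_upwards [this] with v hv
    exact (hh v).apply_eq_zero hv fun z hz => by
      rw [CDiff.smulFun_apply, h0 z hz, zero_smul]
  have hTg := CDiff.norm_le_of_segment (T g) hl (a := w) (b := y)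
    (hsub.trans (by rintro _ ⟨v, -, rfl⟩; exact v.2)) hgw
    (M := C * (2 ^ n * B * M * r⁻¹ ^ n)) (fun z hz => by
      obtain ⟨v, hv, hvz⟩ := hsub hz
      obtain rfl := Subtype.ext hvz
      exact hC g _ (by positivity) hgK v hv)
  rw [(hh y).apply_smulFun hψ hr0 h1, norm_sub_rev] at hTg
  have hdr : dist (h w) (h y) = 2 * r := by
    rw [hr]
    ring
  have hrr : r ^ n * r⁻¹ ^ n = 1 := by
    rw [← mul_pow, mul_inv_cancel₀ hr0.ne', one_pow]
  calc dist (h w) (h y) ^ n * ‖T f y‖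
      ≤ (2 * r) ^ n * (C * (2 ^ n * B * M * r⁻¹ ^ n) * ‖(w : H) - y‖ ^ (n + 1)) := by
        rw [hdr]
        gcongr
    _ = 2 ^ n * (C * (2 ^ n * B * M)) * ‖(w : H) - y‖ ^ (n + 1) * (r ^ n * r⁻¹ ^ n) := by
        rw [mul_pow]
        ring
    _ = _ := by rw [hrr, mul_one]

/-- A map satisfying a Hölder-type estimate of exponent greater than one at each point of a
segment is constant on it. -/
theorem eq_of_dist_pow_le_on_segment {V W : Type*} [NormedAddCommGroup V] [NormedSpace ℝ V]
    [NormedAddCommGroup W] [NormedSpace ℝ W] {n : ℕ} (hn : n ≠ 0) {d : V → W} {a b : V}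
    (hd : ∀ y ∈ segment ℝ a b, ∃ C : ℝ, ∀ᶠ w in 𝓝[segment ℝ a b] y,
      ‖d w - d y‖ ^ n ≤ C * ‖w - y‖ ^ (n + 1)) : d b = d a := by
  have hder : ∀ y ∈ segment ℝ a b, HasFDerivWithinAt d (0 : V →L[ℝ] W) (segment ℝ a b) y := by
    intro y hy
    obtain ⟨C, hC⟩ := hd y hy
    rw [hasFDerivWithinAt_iff_isLittleO, Asymptotics.isLittleO_iff]
    intro ε hε
    have hlim : Tendsto (fun w => C * ‖w - y‖) (𝓝[segment ℝ a b] y) (𝓝 0) := by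
      have : Continuous fun w => C * ‖w - y‖ := by fun_prop
      simpa using (this.tendsto y).mono_left nhdsWithin_le_nhds
    -- Once `C * ‖w - y‖ < ε ^ n`, the hypothesis gives `‖d w - d y‖ ^ n ≤ (ε * ‖w - y‖) ^ n`.
    filter_upwards [hC, hlim.eventually (gt_mem_nhds (pow_pos hε n))] with w hw hw'
    rw [_root_.zero_apply, sub_zero]
    refine le_of_pow_le_pow_left₀ hn (by positivity) (hw.trans ?_)
    rw [mul_pow, pow_succ', ← mul_assoc]
    gcongr
  have h := Convex.norm_image_sub_le_of_norm_hasFDerivWithin_le hder (fun _ _ => norm_zero.le)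
    (convex_segment a b) (left_mem_segment ℝ a b) (right_mem_segment ℝ a b)
  rw [zero_mul] at h
  exact sub_eq_zero.1 (norm_le_zero_iff.1 h)

theorem isLocallyConstant_of_isSupportPoint (hb : HasBumpFunction (n : ℕ∞) G) (hn : n ≠ 0)
    (hnq : (n : ℕ∞) < q) {T : CDiff (n : ℕ∞) X E →ₗ[ℝ] CDiff q Y F} (hT : Continuous T)
    (hnt : IsNowhereTrivial T) {h : Y → X} (hcont : Continuous h)
    (hh : ∀ y, IsSupportPoint T y (h y)) : IsLocallyConstant h := by
  rw [IsLocallyConstant.iff_eventually_eq]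
  intro y₀
  obtain ⟨ε, hε, hball⟩ := Metric.isOpen_iff.1 Y.isOpen y₀ y₀.2
  filter_upwards [Metric.ball_mem_nhds y₀ hε] with y₁ hy₁
  have hS : segment ℝ (y₀ : H) y₁ ⊆ Y :=
    ((convex_ball (y₀ : H) ε).segment_subset (Metric.mem_ball_self hε) hy₁).trans hball
  have hScpt : IsCompact (segment ℝ (y₀ : H) y₁) := by
    rw [segment_eq_image_lineMap]
    exact isCompact_Icc.image AffineMap.lineMap_continuous
  let L : Compacts Y := ⟨(↑) ⁻¹' segment ℝ (y₀ : H) y₁,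
    Topology.IsInducing.subtypeVal.isCompact_preimage' hScpt (by simpa using hS)⟩
  have hLimg : ((↑) : Y → H) '' (L : Set Y) = segment ℝ (y₀ : H) y₁ := by
    change Subtype.val '' (Subtype.val ⁻¹' segment ℝ (y₀ : H) y₁) = _
    rw [image_preimage_eq_iff]
    simpa using hS
  -- The values of `d` outside `Y` play no role, as the segment lies in `Y`.
  let d : H → G := Function.extend Subtype.val (fun y : Y => (h y : G)) 0
  have hdY : ∀ y : Y, d y = h y := fun y => Subtype.val_injective.extend_apply _ _ y
  have key : d y₁ = d y₀ := by
    refine eq_of_dist_pow_le_on_segment hn fun z hz => ?_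
    obtain ⟨C, hC⟩ := exists_dist_pow_le hb hn hnq hT hnt hcont hh L (y := ⟨z, hS hz⟩)
      fun w hw => by
        rw [hLimg]
        exact (convex_segment _ _).segment_subset hw hz
    refine ⟨C, ?_⟩
    rw [eventually_nhdsWithin_iff]
    have hmap := Y.isOpen.isOpenEmbedding_subtypeVal.map_nhds_eq ⟨z, hS hz⟩
    change ∀ᶠ w in 𝓝 ((⟨z, hS hz⟩ : Y) : H), _
    rw [← hmap, eventually_map]
    filter_upwards [hC] with w hw hwS
    have h := hw hwS
    rw [Subtype.dist_eq, dist_eq_norm] at h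
    have hdz := hdY ⟨z, hS hz⟩
    simp only at hdz
    rw [hdY, hdz]
    exact h
  rw [hdY, hdY] at key
  exact Subtype.ext key

end LocalConstancy

/-! ### Assembly: the partition consists of the fibres of `h`. -/

theorem corollary13
    {G : Type*} [NormedAddCommGroup G] [NormedSpace ℝ G] [CompleteSpace G]
    {H : Type*} [NormedAddCommGroup H] [NormedSpace ℝ H] [CompleteSpace H]
    {E : Type*} [NormedAddCommGroup E] [NormedSpace ℝ E] [CompleteSpace E]
    {F : Type*} [NormedAddCommGroup F] [NormedSpace ℝ F] [CompleteSpace F]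
    (X : TopologicalSpace.Opens G) (Y : TopologicalSpace.Opens H)
    (p q : ℕ∞) (hp : 1 ≤ p) (hpq : p < q)
    (hbump : HasBumpFunction p G)
    (T : CDiff p X E →ₗ[ℝ] CDiff q Y F) (hcont : Continuous T)
    (hsep : IsSeparating T) (hnt : IsNowhereTrivial T) :
    ∃ h : Y → X,
      IsSupportMap T (fun y => toCompactif p X (h y.1)) ∧
      (∀ k : nontrivialSet T → Compactif p X, IsSupportMap T k →
        k = fun y => toCompactif p X (h y.1)) ∧
      ∃ P : Set (Set Y), Setoid.IsPartition P ∧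
        ∀ s ∈ P, IsClopen s ∧ ∃ x : X, ∀ y ∈ s, h y = x := by
  obtain ⟨n, rfl⟩ := ENat.ne_top_iff_exists.1 (ne_top_of_lt hpq)
  have hn : n ≠ 0 := by
    have : 1 ≤ n := by exact_mod_cast hp
    omega
  choose h hh using fun y : Y => exists_isSupportPoint hbump T hcont hsep (hnt y)
  have hhc := continuous_of_isSupportPoint hbump hnt hh
  have hloc := isLocallyConstant_of_isSupportPoint hbump hn hpq hcont hnt hhc hh
  refine ⟨h, isSupportMap_of_isSupportPoint hhc hh, fun k hk => hk.eq_of_isSupportPoint hbump hh,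
    (Setoid.ker h).classes, Setoid.isPartition_classes _, ?_⟩
  rintro _ ⟨y, rfl⟩
  exact ⟨hloc.isClopen_fiber (h y), h y, fun z hz => hz⟩
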